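/- Let $M$ be a $C^2$ manifold (Hausdorff, paracompact, without boundary, of finite dimension $n\ge 0$, modelled on Euclidean space $\mathbb{R}^n$). For an open set $O\subset\mathbb{R}^n$, a function $u:O\to\mathbb{R}$ is called locally semi-concave for a linear modulus if every point of $O$ has an open neighbourhood $V\subset O$ for which there is a constant $C$ such that for every $x\in V$ there is a linear form $\ell_x:\mathbb{R}^n\to\mathbb{R}$ with $$u(y)-u(x)\le \ell_x(y-x)+C\|y-x\|^2\quad\text{for all } y\in V;$$ $u$ is locally semi-convex for a linear modulus if $-u$ is locally semi-concave for a linear modulus; and $u$ is $C^{1,1}$ if it is differentiable everywhere and its derivative is locally Lipschitz. A function on $M$ has one of these properties if it has it in every chart of the maximal $C^2$ atlas of $M$. Let $f:M\to\mathbb{R}$ be locally semi-convex for a linear modulus, let $g:M\to\mathbb{R}$ be locally semi-concave for a linear modulus, and suppose that $f\le g$ on $M$. Put $E=\{x\in M : f(x)=g(x)\}$. Then there exists a $C^{1,1}$ function $h:M\to\mathbb{R}$ such that $f\le h\le g$ on $M$ and $f<h<g$ on $M\setminus E$. -/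

import Mathlib

open Set Topology
open scoped Manifold

/-- `f` is semi-concave on `O` with modulus `ω`: there is a constant `C` such that every `x ∈ O`
admits a linear form `ℓ` with `f y - f x ≤ ℓ (y - x) + C ‖y - x‖ ω(‖y - x‖)` for all `y ∈ O`. -/
def SemiconcaveOn {E : Type*} [NormedAddCommGroup E] [NormedSpace ℝ E]
    (ω : ℝ → ℝ) (O : Set E) (f : E → ℝ) : Prop :=
  ∃ C : ℝ, ∀ x ∈ O, ∃ ℓ : E →ₗ[ℝ] ℝ, ∀ y ∈ O,
    f y - f x ≤ ℓ (y - x) + C * ‖y - x‖ * ω ‖y - x‖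

/-- `f` is locally semi-concave on `O` with modulus `ω`. -/
def LocallySemiconcaveOn {E : Type*} [NormedAddCommGroup E] [NormedSpace ℝ E]
    (ω : ℝ → ℝ) (O : Set E) (f : E → ℝ) : Prop :=
  ∀ x ∈ O, ∃ V : Set E, IsOpen V ∧ x ∈ V ∧ V ⊆ O ∧ SemiconcaveOn ω V f

/-- A linear modulus is a function `t ↦ k t` with `k ≥ 0`. -/
def IsLinearModulus (ω : ℝ → ℝ) : Prop :=
  ∃ k : ℝ, 0 ≤ k ∧ ∀ t : ℝ, ω t = k * t

/-- `f` is of class `C^{1,1}` on the open set `O`: it is differentiable at every point of `O`, and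
its derivative is locally Lipschitz on `O`. -/
def IsC11On {E : Type*} [NormedAddCommGroup E] [NormedSpace ℝ E]
    (O : Set E) (f : E → ℝ) : Prop :=
  (∀ x ∈ O, DifferentiableAt ℝ f x) ∧ LocallyLipschitzOn O (fderiv ℝ f)

/-- A function on a `C²` manifold of dimension `n` is locally semi-concave for a linear modulus if
it is so in every chart of the (maximal) `C²` atlas. -/
def MLocallySemiconcave (n : ℕ) {M : Type*} [TopologicalSpace M]
    [ChartedSpace (EuclideanSpace ℝ (Fin n)) M] (f : M → ℝ) : Prop :=
  ∀ e ∈ IsManifold.maximalAtlas (𝓡 n) 2 M,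
    ∃ ω : ℝ → ℝ, IsLinearModulus ω ∧ LocallySemiconcaveOn ω e.target (f ∘ e.symm)

/-- `f` is locally semi-convex for a linear modulus if `-f` is locally semi-concave for a linear
modulus. -/
def MLocallySemiconvex (n : ℕ) {M : Type*} [TopologicalSpace M]
    [ChartedSpace (EuclideanSpace ℝ (Fin n)) M] (f : M → ℝ) : Prop :=
  MLocallySemiconcave n (fun x => -f x)

/-- A function on a `C²` manifold of dimension `n` is of class `C^{1,1}` if it is so in every chart
of the (maximal) `C²` atlas. -/
def MIsC11 (n : ℕ) {M : Type*} [TopologicalSpace M]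
    [ChartedSpace (EuclideanSpace ℝ (Fin n)) M] (h : M → ℝ) : Prop :=
  ∀ e ∈ IsManifold.maximalAtlas (𝓡 n) 2 M, IsC11On e.target (h ∘ e.symm)

/-!
The statement is local: if `h i` solves the problem on the members of a locally finite cover, and
the functions `b i ≥ 0` are `C²` and positive exactly on those members, then
`(∑ b i * h i) / ∑ b i` is a `C^{1,1}` solution on `M`, because the inequalities, strict or not, are
stable under averaging. Locally, multiplying `f` and `g` by a cutoff that is `1` near the given
point reduces to functions on a Euclidean space `E` with `f + K ‖·‖²` convex, `g - K ‖·‖²` concave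
and `f ≤ g` everywhere (`exists_concaveOn_cutoff`).

On `E`, put `G = g + L ‖·‖²` with `L = K + 1`, and let `H` be the convex envelope of `G`. Since
`f + L ‖·‖²` is a convex minorant of `G`, it lies below `H`, so `h = H - L ‖·‖²` satisfies
`f ≤ h ≤ g`. The envelope inherits from `G` the concavity of `G - (K + L) ‖·‖²`
(`concaveOn_convexEnvelope_sub`): for weights `a + b = 1` and a vector `v`, the function
`z ↦ a H (z + b v) + b H (z - a v) - (K + L) a b ‖v‖²` is again a convex minorant of `G`. A convex
function `H` for which `H - C ‖·‖²` is concave has matching quadratic bounds from below and above at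
each point, and is therefore `C^{1,1}` (`differentiable_and_lipschitz_fderiv`).

For strictness, `L > K` allows `f` to be raised near a point where `f < g` by a small concave
paraboloid, so that `f < h` there; exchanging the roles of `f` and `g` gives a second function that
is `< g` off the contact set, and the mean of the two is strict on both sides.
-/

/-! ### The convex envelope of a semi-concave function -/

/-- The convex envelope of `G`: the pointwise supremum of the convex functions below `G`. It is
meaningful when `G` has at least one convex minorant. -/
noncomputable def convexEnvelope {E : Type*} [AddCommGroup E] [Module ℝ E] (G : E → ℝ) (x : E) : ℝ :=
  sSup {t | ∃ c : E → ℝ, ConvexOn ℝ univ c ∧ (∀ y, c y ≤ G y) ∧ c x = t}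

section Envelope

variable {E : Type*} [AddCommGroup E] [Module ℝ E]

theorem le_convexEnvelope {c G : E → ℝ} (hc : ConvexOn ℝ univ c) (hcG : ∀ y, c y ≤ G y) (x : E) :
    c x ≤ convexEnvelope G x :=
  le_csSup ⟨G x, by rintro t ⟨d, -, hd, rfl⟩; exact hd x⟩ ⟨c, hc, hcG, rfl⟩

theorem convexEnvelope_le {F G : E → ℝ} (hF : ConvexOn ℝ univ F) (hFG : ∀ y, F y ≤ G y) {x : E}
    {a : ℝ} (h : ∀ c : E → ℝ, ConvexOn ℝ univ c → (∀ y, c y ≤ G y) → c x ≤ a) :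
    convexEnvelope G x ≤ a :=
  csSup_le ⟨F x, F, hF, hFG, rfl⟩ (by rintro t ⟨c, hc, hcG, rfl⟩; exact h c hc hcG)

theorem convexOn_convexEnvelope {F G : E → ℝ} (hF : ConvexOn ℝ univ F) (hFG : ∀ y, F y ≤ G y) :
    ConvexOn ℝ univ (convexEnvelope G) := by
  refine ⟨convex_univ, fun x _ y _ a b ha hb hab => convexEnvelope_le hF hFG fun c hc hcG => ?_⟩
  refine (hc.2 (mem_univ x) (mem_univ y) ha hb hab).trans ?_
  have h1 := le_convexEnvelope hc hcG x
  have h2 := le_convexEnvelope hc hcG y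
  simp only [smul_eq_mul]
  gcongr

end Envelope

section Analysis

variable {E : Type*} [NormedAddCommGroup E] [InnerProductSpace ℝ E]

theorem norm_sq_combo (x y : E) {a b : ℝ} (hab : a + b = 1) :
    ‖a • x + b • y‖ ^ 2 = a * ‖x‖ ^ 2 + b * ‖y‖ ^ 2 - a * b * ‖x - y‖ ^ 2 := by
  rw [norm_add_sq_real, norm_sub_sq_real, norm_smul, norm_smul, inner_smul_left, inner_smul_right,
    mul_pow, mul_pow, Real.norm_eq_abs, Real.norm_eq_abs, sq_abs, sq_abs]
  obtain rfl : b = 1 - a := by linarith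
  simp only [RCLike.conj_to_real]
  ring

/-- The convex envelope inherits semi-concavity: a weighted average of two translates of it, lowered
by the semi-concavity defect, is again a convex minorant of `G`. -/
theorem concaveOn_convexEnvelope_sub {F G : E → ℝ} {L : ℝ} (hF : ConvexOn ℝ univ F)
    (hFG : ∀ y, F y ≤ G y) (hG : ConcaveOn ℝ univ (fun x => G x - L * ‖x‖ ^ 2)) :
    ConcaveOn ℝ univ (fun x => convexEnvelope G x - L * ‖x‖ ^ 2) := by
  have hH := convexOn_convexEnvelope hF hFG
  refine ⟨convex_univ, fun x _ y _ a b ha hb hab => ?_⟩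
  have key : ∀ z, a * convexEnvelope G (z + b • (x - y)) + b * convexEnvelope G (z - a • (x - y))
      - L * (a * b * ‖x - y‖ ^ 2) ≤ convexEnvelope G z := by
    refine le_convexEnvelope ?_ fun z => ?_
    · have h1 : ConvexOn ℝ univ fun z => convexEnvelope G (z + b • (x - y)) :=
        hH.translate_left (b • (x - y))
      have h2 : ConvexOn ℝ univ fun z => convexEnvelope G (z - a • (x - y)) := by
        simp only [sub_eq_add_neg _ (a • (x - y))]
        exact hH.translate_left _
      exact ((h1.smul ha).add (h2.smul hb)).sub (concaveOn_const _ convex_univ)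
    · have e1 : convexEnvelope G (z + b • (x - y)) ≤ G (z + b • (x - y)) :=
        convexEnvelope_le hF hFG fun c _ hc => hc _
      have e2 : convexEnvelope G (z - a • (x - y)) ≤ G (z - a • (x - y)) :=
        convexEnvelope_le hF hFG fun c _ hc => hc _
      have h3 := hG.2 (mem_univ (z + b • (x - y))) (mem_univ (z - a • (x - y))) ha hb hab
      have h4 := norm_sq_combo (z + b • (x - y)) (z - a • (x - y)) hab
      have h5 : a • (z + b • (x - y)) + b • (z - a • (x - y)) = z := by
        have : a • (z + b • (x - y)) + b • (z - a • (x - y)) = (a + b) • z := by module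
        rw [this, hab, one_smul]
      have h6 : z + b • (x - y) - (z - a • (x - y)) = x - y := by
        have : z + b • (x - y) - (z - a • (x - y)) = (a + b) • (x - y) := by module
        rw [this, hab, one_smul]
      simp only [h5, smul_eq_mul] at h3
      rw [h5, h6] at h4
      have h7 := mul_le_mul_of_nonneg_left e1 ha
      have h8 := mul_le_mul_of_nonneg_left e2 hb
      rw [h4] at h3
      linarith
  have h := key (a • x + b • y)
  have h5 : a • x + b • y + b • (x - y) = x := by
    have : a • x + b • y + b • (x - y) = (a + b) • x := by module
    rw [this, hab, one_smul]
  have h6 : a • x + b • y - a • (x - y) = y := by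
    have : a • x + b • y - a • (x - y) = (a + b) • y := by module
    rw [this, hab, one_smul]
  rw [h5, h6] at h
  simp only [smul_eq_mul, norm_sq_combo x y hab]
  linarith

variable [FiniteDimensional ℝ E]

/-! ### Functions that are both semi-convex and semi-concave are `C^{1,1}` -/

/-- A finite convex function has a subgradient at every point: separate the point `(x, H x)` from
the strict epigraph of `H`. -/
theorem ConvexOn.exists_subgradient {H : E → ℝ} (hH : ConvexOn ℝ univ H) (x : E) :
    ∃ p : E →L[ℝ] ℝ, ∀ y, H x + p (y - x) ≤ H y := by
  have hcont : Continuous H := continuousOn_univ.1 (hH.continuousOn isOpen_univ)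
  have hconv : Convex ℝ {p : E × ℝ | H p.1 < p.2} := by simpa using hH.convex_strict_epigraph
  have hopen : IsOpen {p : E × ℝ | H p.1 < p.2} :=
    isOpen_lt (hcont.comp continuous_fst) continuous_snd
  obtain ⟨φ, hφ⟩ := geometric_hahn_banach_open_point hconv hopen (x := (x, H x)) (by simp)
  set β : ℝ := φ (0, 1)
  set α : E →L[ℝ] ℝ := φ.comp (ContinuousLinearMap.inl ℝ E ℝ)
  have hdec : ∀ y t, φ (y, t) = α y + t * β := fun y t => by
    have : ((y, t) : E × ℝ) = (y, 0) + t • (0, 1) := by simp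
    rw [this, map_add, map_smul]; rfl
  have hlt : ∀ y t, H y < t → α y + t * β < α x + H x * β := fun y t h => by
    have := hφ (y, t) h
    rwa [hdec, hdec] at this
  have hβ : β < 0 := by
    have := hlt x (H x + 1) (by linarith)
    linarith
  refine ⟨(-β)⁻¹ • α, fun y => ?_⟩
  have hle : α y + H y * β ≤ α x + H x * β := by
    refine le_of_forall_pos_lt_add fun ε hε => ?_
    have := hlt y (H y + ε / (-β)) (by have := div_pos hε (neg_pos.2 hβ); linarith)
    have e : ε / (-β) * β = -ε := by rw [div_neg, neg_mul, div_mul_cancel₀ _ hβ.ne]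
    nlinarith
  have : (-β)⁻¹ * (α y - α x) ≤ H y - H x := by
    rw [inv_mul_le_iff₀ (neg_pos.2 hβ)]
    linarith
  simp only [smul_apply, map_sub, smul_eq_mul]
  linarith

/-- The subgradient of `H` and the supergradient of `H - L ‖·‖²` squeeze `H` between two functions
that agree to first order. -/
theorem exists_forall_abs_sub_le {H : E → ℝ} {L : ℝ} (hH : ConvexOn ℝ univ H)
    (hH' : ConcaveOn ℝ univ (fun x => H x - L * ‖x‖ ^ 2)) (x : E) :
    ∃ p : E →L[ℝ] ℝ, ∀ y, H x + p (y - x) ≤ H y ∧ H y ≤ H x + p (y - x) + L * ‖y - x‖ ^ 2 := by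
  obtain ⟨p, hp⟩ := hH.exists_subgradient x
  obtain ⟨q, hq⟩ := hH'.neg.exists_subgradient x
  set r : E →L[ℝ] ℝ := (2 * L) • innerSL ℝ x - q
  have hr : ∀ y, H y ≤ H x + r (y - x) + L * ‖y - x‖ ^ 2 := fun y => by
    have h1 := hq y
    have h2 : ‖y‖ ^ 2 = ‖x‖ ^ 2 + 2 * inner ℝ x (y - x) + ‖y - x‖ ^ 2 := by
      rw [← norm_add_sq_real]; congr 2; abel
    simp only [Pi.neg_apply] at h1
    simp only [r, sub_apply, smul_apply,
      innerSL_apply_apply, smul_eq_mul]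
    rw [h2] at h1
    linarith
  have hs : ∀ w, p w ≤ r w := fun w => by
    refine le_of_forall_pos_le_add fun ε hε => ?_
    -- test the two inequalities at `x + t w` with `t > 0` small
    obtain ⟨t, ht, htε⟩ : ∃ t : ℝ, 0 < t ∧ t * (|L| * ‖w‖ ^ 2) ≤ ε := by
      refine ⟨ε / (|L| * ‖w‖ ^ 2 + 1), by positivity, ?_⟩
      rw [div_mul_eq_mul_div, div_le_iff₀ (by positivity)]
      nlinarith [show 0 ≤ |L| * ‖w‖ ^ 2 by positivity]
    have h1 := (hp (x + t • w)).trans (hr (x + t • w))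
    simp only [add_sub_cancel_left, map_smul, smul_eq_mul, norm_smul, mul_pow, Real.norm_eq_abs,
      sq_abs] at h1
    have h2 : L * ‖w‖ ^ 2 ≤ |L| * ‖w‖ ^ 2 := by gcongr; exact le_abs_self L
    refine le_of_mul_le_mul_left ?_ ht
    nlinarith [mul_le_mul_of_nonneg_left h2 (sq_nonneg t), mul_le_mul_of_nonneg_left htε ht.le]
  have hpr : p = r := by
    ext w
    have h1 := hs (-w)
    simp only [map_neg] at h1
    exact le_antisymm (hs w) (by linarith)
  exact ⟨p, fun y => ⟨hp y, hpr ▸ hr y⟩⟩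

open scoped NNReal in
/-- A convex function `H` with `H - L ‖·‖²` concave is differentiable with `2L`-Lipschitz
derivative. -/
theorem differentiable_and_lipschitz_fderiv {H : E → ℝ} {L : ℝ} (hL : 0 ≤ L)
    (hH : ConvexOn ℝ univ H) (hH' : ConcaveOn ℝ univ (fun x => H x - L * ‖x‖ ^ 2)) :
    Differentiable ℝ H ∧ ∃ C : ℝ≥0, LipschitzWith C (fderiv ℝ H) := by
  choose p hp using exists_forall_abs_sub_le hH hH'
  have hd : ∀ x, HasFDerivAt H (p x) x := fun x => by
    refine HasFDerivAt.of_isLittleO ?_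
    have h1 : (fun y => H y - H x - p x (y - x)) =O[𝓝 x] fun y => ‖y - x‖ ^ 2 := by
      refine Asymptotics.IsBigO.of_bound L (Filter.Eventually.of_forall fun y => ?_)
      obtain ⟨h1, h2⟩ := hp x y
      rw [Real.norm_eq_abs, Real.norm_eq_abs, abs_of_nonneg (by linarith),
        abs_of_nonneg (by positivity)]
      linarith
    exact h1.trans_isLittleO (Asymptotics.isLittleO_pow_sub_sub x one_lt_two)
  refine ⟨fun x => (hd x).differentiableAt, (2 * L).toNNReal, ?_⟩
  have hf : fderiv ℝ H = p := funext fun x => (hd x).fderiv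
  rw [hf]
  refine LipschitzWith.of_dist_le_mul fun y x => ?_
  have hbound : ∀ w, p y w - p x w ≤ L * ‖y - x‖ ^ 2 + L * ‖w‖ ^ 2 := fun w => by
    have h1 := (hp y (x + w)).1
    have h2 := (hp x (x + w)).2
    have h3 := (hp y x).2
    have h4 : x + w - y = (x - y) + w := by abel
    rw [h4, map_add] at h1
    rw [add_sub_cancel_left] at h2
    rw [norm_sub_rev x y] at h3
    linarith
  rcases eq_or_ne y x with rfl | hne
  · simp
  have hpos : 0 < ‖y - x‖ := norm_pos_iff.2 (sub_ne_zero.2 hne)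
  rw [dist_eq_norm, dist_eq_norm, Real.coe_toNNReal _ (by positivity)]
  have hscaled : ∀ w, p y w - p x w ≤ 2 * L * ‖y - x‖ * ‖w‖ := fun w => by
    rcases eq_or_ne w 0 with rfl | hw
    · simp
    have hw' : 0 < ‖w‖ := norm_pos_iff.2 hw
    -- the quadratic bound is optimal for vectors of norm `‖y - x‖`
    have h := hbound ((‖y - x‖ / ‖w‖) • w)
    rw [norm_smul, Real.norm_eq_abs, abs_of_nonneg (by positivity), div_mul_cancel₀ _ hw'.ne',
      map_smul, map_smul, smul_eq_mul, smul_eq_mul, ← mul_sub, div_mul_eq_mul_div,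
      div_le_iff₀ hw'] at h
    refine le_of_mul_le_mul_left (h.trans_eq ?_) hpos
    ring
  refine ContinuousLinearMap.opNorm_le_bound _ (by positivity) fun w => ?_
  rw [sub_apply, Real.norm_eq_abs, abs_le]
  have h := hscaled (-w)
  simp only [map_neg, norm_neg] at h
  exact ⟨by linarith, hscaled w⟩

end Analysis

/-! ### Calculus of `C^{1,1}` maps -/

section Calculus

open scoped NNReal

variable {E F G : Type*} [NormedAddCommGroup E] [NormedSpace ℝ E] [NormedAddCommGroup F]
  [NormedSpace ℝ F] [NormedAddCommGroup G] [NormedSpace ℝ G]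

/-- `f` is of class `C^{1,1}` near `x`: it is differentiable, with Lipschitz derivative, on some
neighbourhood of `x`. -/
def C11At (f : E → F) (x : E) : Prop :=
  (∀ᶠ y in 𝓝 x, DifferentiableAt ℝ f y) ∧ ∃ K : ℝ≥0, ∃ s ∈ 𝓝 x, LipschitzOnWith K (fderiv ℝ f) s

theorem isC11On_of_forall_c11At {O : Set E} {f : E → ℝ} (h : ∀ x ∈ O, C11At f x) : IsC11On O f :=
  ⟨fun x hx => (h x hx).1.self_of_nhds, fun x hx =>
    let ⟨K, s, hs, hK⟩ := (h x hx).2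
    ⟨K, s, mem_nhdsWithin_of_mem_nhds hs, hK⟩⟩

theorem exists_lipschitzOnWith_comp {X Y Z : Type*} [PseudoEMetricSpace X] [PseudoEMetricSpace Y]
    [PseudoEMetricSpace Z] {g : Y → Z} {f : X → Y} {x : X}
    (hg : ∃ K : ℝ≥0, ∃ s ∈ 𝓝 (f x), LipschitzOnWith K g s)
    (hf : ∃ K : ℝ≥0, ∃ s ∈ 𝓝 x, LipschitzOnWith K f s) :
    ∃ K : ℝ≥0, ∃ s ∈ 𝓝 x, LipschitzOnWith K (g ∘ f) s := by
  obtain ⟨K, s, hs, hK⟩ := hg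
  obtain ⟨K', s', hs', hK'⟩ := hf
  have hc : ContinuousAt f x := hK'.continuousOn.continuousAt hs'
  refine ⟨K * K', s' ∩ f ⁻¹' s, Filter.inter_mem hs' (hc hs), ?_⟩
  exact hK.comp (hK'.mono inter_subset_left) fun y hy => hy.2

theorem exists_lipschitzOnWith_prodMk {X Y Z : Type*} [PseudoEMetricSpace X]
    [PseudoEMetricSpace Y] [PseudoEMetricSpace Z] {g : X → Z} {f : X → Y} {x : X}
    (hf : ∃ K : ℝ≥0, ∃ s ∈ 𝓝 x, LipschitzOnWith K f s)
    (hg : ∃ K : ℝ≥0, ∃ s ∈ 𝓝 x, LipschitzOnWith K g s) :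
    ∃ K : ℝ≥0, ∃ s ∈ 𝓝 x, LipschitzOnWith K (fun y => (f y, g y)) s := by
  obtain ⟨K, s, hs, hK⟩ := hf
  obtain ⟨K', s', hs', hK'⟩ := hg
  exact ⟨_, s ∩ s', Filter.inter_mem hs hs',
    (hK.mono inter_subset_left).prodMk (hK'.mono inter_subset_right)⟩

theorem exists_lipschitzOnWith_congr {X Y : Type*} [PseudoEMetricSpace X] [PseudoEMetricSpace Y]
    {f g : X → Y} {x : X} (hf : ∃ K : ℝ≥0, ∃ s ∈ 𝓝 x, LipschitzOnWith K f s)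
    (hfg : g =ᶠ[𝓝 x] f) : ∃ K : ℝ≥0, ∃ s ∈ 𝓝 x, LipschitzOnWith K g s := by
  obtain ⟨K, s, hs, hK⟩ := hf
  refine ⟨K, s ∩ {y | g y = f y}, Filter.inter_mem hs hfg, fun y hy z hz => ?_⟩
  rw [hy.2, hz.2]
  exact hK hy.1 hz.1

theorem C11At.congr_of_eventuallyEq {f g : E → F} {x : E} (hf : C11At f x) (hfg : g =ᶠ[𝓝 x] f) :
    C11At g x := by
  refine ⟨?_, exists_lipschitzOnWith_congr hf.2 hfg.fderiv⟩
  filter_upwards [hf.1, hfg.eventuallyEq_nhds] with y hy hy'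
  exact hy.congr_of_eventuallyEq hy'

theorem ContDiffAt.c11At {f : E → F} {x : E} (hf : ContDiffAt ℝ 2 f x) : C11At f x := by
  refine ⟨?_, (hf.fderiv_right (m := 1) (by norm_num)).exists_lipschitzOnWith⟩
  filter_upwards [hf.eventually (by simp)] with y hy
  exact hy.differentiableAt (by simp)

theorem C11At.exists_lipschitzOnWith {f : E → F} {x : E} (hf : C11At f x) :
    ∃ K : ℝ≥0, ∃ s ∈ 𝓝 x, LipschitzOnWith K f s := by
  obtain ⟨K, s, hs, hK⟩ := hf.2
  exact (hasStrictFDerivAt_of_hasFDerivAt_of_continuousAt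
    (hf.1.mono fun y hy => hy.hasFDerivAt)
    (hK.continuousOn.continuousAt hs)).exists_lipschitzOnWith

theorem C11At.continuousAt {f : E → F} {x : E} (hf : C11At f x) : ContinuousAt f x :=
  hf.1.self_of_nhds.continuousAt

theorem C11At.comp {g : F → G} {f : E → F} {x : E} (hg : C11At g (f x)) (hf : C11At f x) :
    C11At (g ∘ f) x := by
  have hg' := hf.continuousAt.eventually hg.1
  constructor
  · filter_upwards [hf.1, hg'] with y hy hy'
    exact hy'.comp y hy
  · have h1 := exists_lipschitzOnWith_prodMk
      (exists_lipschitzOnWith_comp hg.2 hf.exists_lipschitzOnWith) hf.2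
    have h2 : ContDiff ℝ 1 fun p : (F →L[ℝ] G) × (E →L[ℝ] F) => p.1.comp p.2 :=
      isBoundedBilinearMap_comp.contDiff
    refine exists_lipschitzOnWith_congr
      (exists_lipschitzOnWith_comp h2.contDiffAt.exists_lipschitzOnWith h1) ?_
    filter_upwards [hf.1, hg'] with y hy hy'
    exact fderiv_comp y hy' hy

theorem C11At.add {f g : E → F} {x : E} (hf : C11At f x) (hg : C11At g x) :
    C11At (fun y => f y + g y) x := by
  constructor
  · filter_upwards [hf.1, hg.1] with y hy hy'
    exact hy.add hy'
  · have h2 : ContDiff ℝ 1 fun p : (E →L[ℝ] F) × (E →L[ℝ] F) => p.1 + p.2 := contDiff_add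
    refine exists_lipschitzOnWith_congr (exists_lipschitzOnWith_comp
      h2.contDiffAt.exists_lipschitzOnWith (exists_lipschitzOnWith_prodMk hf.2 hg.2)) ?_
    filter_upwards [hf.1, hg.1] with y hy hy'
    exact fderiv_fun_add hy hy'

theorem C11At.prodMk {f : E → F} {g : E → G} {x : E} (hf : C11At f x) (hg : C11At g x) :
    C11At (fun y => (f y, g y)) x := by
  have h1 := (ContinuousLinearMap.inl ℝ F G).contDiff.contDiffAt.c11At.comp hf
  have h2 := (ContinuousLinearMap.inr ℝ F G).contDiff.contDiffAt.c11At.comp hg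
  simpa using h1.add h2

theorem C11At.mul {f g : E → ℝ} {x : E} (hf : C11At f x) (hg : C11At g x) :
    C11At (fun y => f y * g y) x :=
  C11At.comp (g := fun p : ℝ × ℝ => p.1 * p.2) contDiff_mul.contDiffAt.c11At (hf.prodMk hg)

theorem C11At.div {f g : E → ℝ} {x : E} (hf : C11At f x) (hg : C11At g x) (h0 : g x ≠ 0) :
    C11At (fun y => f y / g y) x :=
  C11At.comp (g := fun p : ℝ × ℝ => p.1 / p.2)
    (contDiffAt_fst.div contDiffAt_snd h0).c11At (hf.prodMk hg)

theorem C11At.const_mul {f : E → ℝ} {x : E} (a : ℝ) (hf : C11At f x) :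
    C11At (fun y => a * f y) x :=
  contDiffAt_const.c11At.mul hf

theorem C11At.sum {ι : Type*} {f : ι → E → ℝ} {x : E} (s : Finset ι)
    (hf : ∀ i ∈ s, C11At (f i) x) : C11At (fun y => ∑ i ∈ s, f i y) x := by
  classical
  induction s using Finset.induction_on with
  | empty => simpa using (contDiffAt_const (c := (0 : ℝ))).c11At
  | insert i s hi ih =>
    simp only [Finset.sum_insert hi]
    exact (hf i (Finset.mem_insert_self i s)).add
      (ih fun j hj => hf j (Finset.mem_insert_of_mem hj))

end Calculus

/-! ### Insertion on Euclidean space -/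

section Insertion

variable {E : Type*} [NormedAddCommGroup E] [InnerProductSpace ℝ E]

theorem convexOn_const_mul_norm_sq {a : ℝ} (ha : 0 ≤ a) :
    ConvexOn ℝ univ fun x : E => a * ‖x‖ ^ 2 := by
  refine ⟨convex_univ, fun x _ y _ s t hs ht hst => ?_⟩
  simp only [norm_sq_combo x y hst, smul_eq_mul]
  have : 0 ≤ a * (s * t * ‖x - y‖ ^ 2) := by positivity
  linarith

variable [FiniteDimensional ℝ E]

/-- The function inserted is the convex envelope of `g + (K + 1) ‖·‖²`, corrected by
`(K + 1) ‖·‖²`. The `1` in excess of `K` leaves room above `f` for a paraboloid of opening `1`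
wherever `f < g`, and that gives `f < h` there. -/
theorem exists_c11_between_strict_left {f g : E → ℝ} {K : ℝ} (hK : 0 ≤ K)
    (hf : ConvexOn ℝ univ fun x => f x + K * ‖x‖ ^ 2)
    (hg : ConcaveOn ℝ univ fun x => g x - K * ‖x‖ ^ 2) (hfg : ∀ x, f x ≤ g x) :
    ∃ h : E → ℝ, (∀ x, C11At h x) ∧ (∀ x, f x ≤ h x ∧ h x ≤ g x) ∧
      ∀ x, f x < g x → f x < h x := by
  set F : E → ℝ := fun x => f x + (K + 1) * ‖x‖ ^ 2
  set G : E → ℝ := fun x => g x + (K + 1) * ‖x‖ ^ 2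
  have hF : ConvexOn ℝ univ F := by
    refine (hf.add (convexOn_const_mul_norm_sq zero_le_one)).congr fun x _ => ?_
    simp only [F, Pi.add_apply]; ring
  have hFG : ∀ x, F x ≤ G x := fun x => by simpa [F, G] using hfg x
  have hG : ConcaveOn ℝ univ fun x => G x - (2 * K + 1) * ‖x‖ ^ 2 := by
    refine hg.congr fun x _ => ?_
    simp only [G]; ring
  have hH := convexOn_convexEnvelope hF hFG
  obtain ⟨hd, C, hC⟩ := differentiable_and_lipschitz_fderiv (by positivity) hH
    (concaveOn_convexEnvelope_sub hF hFG hG)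
  have hHc : ∀ x, C11At (convexEnvelope G) x := fun x =>
    ⟨Filter.Eventually.of_forall hd, C, univ, Filter.univ_mem, hC.lipschitzOnWith⟩
  refine ⟨fun x => convexEnvelope G x + -(K + 1) * ‖x‖ ^ 2, fun x => ?_, fun x => ⟨?_, ?_⟩,
    fun x hx => ?_⟩
  · exact (hHc x).add ((contDiff_norm_sq ℝ).contDiffAt.c11At.const_mul _)
  · have h1 := le_convexEnvelope hF hFG x
    simp only [F] at h1
    linarith
  · have h1 : convexEnvelope G x ≤ G x := convexEnvelope_le hF hFG fun c _ hc => hc x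
    simp only [G] at h1
    linarith
  · have hfc : Continuous fun x => f x + K * ‖x‖ ^ 2 :=
      continuousOn_univ.1 (hf.continuousOn isOpen_univ)
    have hgc : Continuous fun x => g x - K * ‖x‖ ^ 2 :=
      continuousOn_univ.1 (hg.continuousOn isOpen_univ)
    have hq : Continuous fun x : E => K * ‖x‖ ^ 2 := by fun_prop
    have huc : Continuous fun x => g x - f x :=
      ((hgc.sub hfc).add (hq.add hq)).congr fun x => by
        simp only [Pi.add_apply, Pi.sub_apply]; ring
    obtain ⟨r, hr, hball⟩ := Metric.eventually_nhds_iff.1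
      (huc.continuousAt.eventually (lt_mem_nhds (show (g x - f x) / 2 < g x - f x by linarith)))
    set c := min ((g x - f x) / 2) (r ^ 2)
    have hc : 0 < c := lt_min (by linarith) (by positivity)
    have hP : ConvexOn ℝ univ fun y => (f y + K * ‖y‖ ^ 2) + (c + (‖y‖ ^ 2 - ‖y - x‖ ^ 2)) := by
      refine hf.add ⟨convex_univ, fun y _ z _ s t hs ht hst => le_of_eq ?_⟩
      simp only [norm_sub_sq_real, inner_add_left, inner_smul_left, RCLike.conj_to_real,
        smul_eq_mul]
      obtain rfl : t = 1 - s := by linarith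
      ring
    have hPG : ∀ y, (f y + K * ‖y‖ ^ 2) + (c + (‖y‖ ^ 2 - ‖y - x‖ ^ 2)) ≤ G y := fun y => by
      have : c - ‖y - x‖ ^ 2 ≤ g y - f y := by
        by_cases hy : dist y x < r
        · have h1 := hball hy
          have h2 : c ≤ (g x - f x) / 2 := min_le_left _ _
          nlinarith [sq_nonneg ‖y - x‖]
        · have h1 : r ^ 2 ≤ ‖y - x‖ ^ 2 := by
            rw [← dist_eq_norm]; exact pow_le_pow_left₀ hr.le (not_lt.1 hy) 2
          have h2 : c ≤ r ^ 2 := min_le_right _ _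
          linarith [hfg y]
      simp only [G]
      linarith
    have h1 := le_convexEnvelope hP hPG x
    simp only [sub_self, norm_zero] at h1
    nlinarith

/-- The mean of an insertion strictly above `f` and of one strictly below `g`. -/
theorem exists_c11_between_strict {f g : E → ℝ} {K : ℝ} (hK : 0 ≤ K)
    (hf : ConvexOn ℝ univ fun x => f x + K * ‖x‖ ^ 2)
    (hg : ConcaveOn ℝ univ fun x => g x - K * ‖x‖ ^ 2) (hfg : ∀ x, f x ≤ g x) :
    ∃ h : E → ℝ, (∀ x, C11At h x) ∧ (∀ x, f x ≤ h x ∧ h x ≤ g x) ∧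
      ∀ x, f x < g x → f x < h x ∧ h x < g x := by
  obtain ⟨h₁, hd₁, hb₁, hs₁⟩ := exists_c11_between_strict_left hK hf hg hfg
  obtain ⟨h₂, hd₂, hb₂, hs₂⟩ := exists_c11_between_strict_left (f := fun x => -g x)
    (g := fun x => -f x) hK (hg.neg.congr fun x _ => by simp only [Pi.neg_apply]; ring)
    (hf.neg.congr fun x _ => by simp only [Pi.neg_apply]; ring)
    (fun x => neg_le_neg (hfg x))
  refine ⟨fun x => 2⁻¹ * h₁ x + -2⁻¹ * h₂ x, fun x => ((hd₁ x).const_mul _).add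
    ((hd₂ x).const_mul _), fun x => ?_, fun x hx => ?_⟩
  · have := hb₁ x; have := hb₂ x
    constructor <;> linarith
  · have := hb₁ x; have := hb₂ x; have := hs₁ x hx; have := hs₂ x (neg_lt_neg hx)
    constructor <;> linarith

end Insertion

/-! ### Localization by a cutoff -/

section Cutoff

variable {E : Type*} [NormedAddCommGroup E] [InnerProductSpace ℝ E]

/-- Quadratic supergradients at all points make `g - K ‖·‖²` concave. -/
theorem concaveOn_sub_of_supergradient {g : E → ℝ} {K : ℝ}
    (h : ∀ x, ∃ ℓ : E →ₗ[ℝ] ℝ, ∀ y, g y - g x ≤ ℓ (y - x) + K * ‖y - x‖ ^ 2) :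
    ConcaveOn ℝ univ fun x => g x - K * ‖x‖ ^ 2 := by
  refine ⟨convex_univ, fun x _ y _ a b ha hb hab => ?_⟩
  obtain ⟨ℓ, hℓ⟩ := h (a • x + b • y)
  have hx : x - (a • x + b • y) = b • (x - y) := by
    obtain rfl : a = 1 - b := by linarith
    module
  have hy : y - (a • x + b • y) = (-a) • (x - y) := by
    obtain rfl : b = 1 - a := by linarith
    module
  have h1 := hℓ x
  have h2 := hℓ y
  rw [hx, map_smul, norm_smul, mul_pow, Real.norm_eq_abs, sq_abs, smul_eq_mul] at h1
  rw [hy, map_smul, norm_smul, mul_pow, Real.norm_eq_abs, sq_abs, smul_eq_mul] at h2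
  simp only [smul_eq_mul, norm_sq_combo x y hab]
  have h3 := mul_le_mul_of_nonneg_left h1 ha
  have h4 := mul_le_mul_of_nonneg_left h2 hb
  obtain rfl : b = 1 - a := by linarith
  linarith

/-- A compactly supported `C²` function is Lipschitz and has a uniform second-order Taylor bound. -/
theorem ContDiff.exists_taylor_bound_of_hasCompactSupport {φ : E → ℝ} (hφ : ContDiff ℝ 2 φ)
    (hs : HasCompactSupport φ) :
    ∃ A : ℝ, 0 ≤ A ∧ (∀ x y, |φ y - φ x| ≤ A * ‖y - x‖) ∧ (∀ x, ‖fderiv ℝ φ x‖ ≤ A) ∧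
      ∀ x y, |φ y - φ x - fderiv ℝ φ x (y - x)| ≤ A * ‖y - x‖ ^ 2 := by
  obtain ⟨A, hA⟩ := ContDiff.lipschitzWith_of_hasCompactSupport hs hφ two_ne_zero
  obtain ⟨B, hB⟩ := ContDiff.lipschitzWith_of_hasCompactSupport (hs.fderiv ℝ)
    (hφ.fderiv_right (m := 1) (by norm_num)) one_ne_zero
  refine ⟨max A B, by positivity, fun x y => ?_, fun x => ?_, fun x y => ?_⟩
  · have h := hA.dist_le_mul y x
    rw [Real.dist_eq, dist_eq_norm] at h
    exact h.trans (by gcongr; exact le_max_left _ _)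
  · exact (norm_fderiv_le_of_lipschitz ℝ hA).trans (le_max_left _ _)
  · have h := (convex_closedBall x ‖y - x‖).norm_image_sub_le_of_norm_hasFDerivWithin_le'
      (f := φ) (f' := fderiv ℝ φ) (φ := fderiv ℝ φ x) (C := B * ‖y - x‖) (x := x) (y := y)
      (fun z _ => (hφ.differentiable (by simp) z).hasFDerivAt.hasFDerivWithinAt)
      (fun z hz => by
        have h := hB.dist_le_mul z x
        rw [dist_eq_norm] at h
        rw [Metric.mem_closedBall] at hz
        exact h.trans (by gcongr))
      (by simp) (by simp [dist_eq_norm])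
    rw [Real.norm_eq_abs] at h
    refine h.trans ?_
    rw [mul_assoc, ← sq]
    gcongr
    exact le_max_right _ _

/-- For a linear modulus, `g` has quadratic supergradients on some ball around each point, with a
nonnegative constant. -/
theorem LocallySemiconcaveOn.exists_ball {g : E → ℝ} {ω : ℝ → ℝ} {O : Set E}
    (hω : IsLinearModulus ω) (hg : LocallySemiconcaveOn ω O g) {x₀ : E} (hx₀ : x₀ ∈ O) :
    ∃ K : ℝ, 0 ≤ K ∧ ∃ ρ > 0, Metric.ball x₀ ρ ⊆ O ∧ ∀ x ∈ Metric.ball x₀ ρ,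
      ∃ ℓ : E →ₗ[ℝ] ℝ, ∀ y ∈ Metric.ball x₀ ρ, g y - g x ≤ ℓ (y - x) + K * ‖y - x‖ ^ 2 := by
  obtain ⟨k, -, hk⟩ := hω
  obtain ⟨V, hV, hxV, hVO, C, hC⟩ := hg x₀ hx₀
  obtain ⟨ρ, hρ, hρV⟩ := Metric.isOpen_iff.1 hV x₀ hxV
  refine ⟨|C * k|, abs_nonneg _, ρ, hρ, hρV.trans hVO, fun x hx => ?_⟩
  obtain ⟨ℓ, hℓ⟩ := hC x (hρV hx)
  refine ⟨ℓ, fun y hy => (hℓ y (hρV hy)).trans ?_⟩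
  rw [hk]
  have : C * k * ‖y - x‖ ^ 2 ≤ |C * k| * ‖y - x‖ ^ 2 := by gcongr; exact le_abs_self _
  linarith

variable [FiniteDimensional ℝ E]

/-- Cutting off a bounded function that is semi-concave on a ball leaves a function that is
semi-concave on the whole space. -/
theorem exists_concaveOn_cutoff {g φ : E → ℝ} {x₀ : E} {r K M : ℝ} (hr : 0 < r) (hK : 0 ≤ K)
    (hφ : ContDiff ℝ 2 φ) (hφ01 : ∀ x, 0 ≤ φ x ∧ φ x ≤ 1)
    (hφs : ∀ x ∉ Metric.ball x₀ r, φ x = 0)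
    (hM : ∀ x ∈ Metric.ball x₀ (4 * r), |g x| ≤ M)
    (hg : ∀ x ∈ Metric.ball x₀ (4 * r), ∃ ℓ : E →ₗ[ℝ] ℝ, ∀ y ∈ Metric.ball x₀ (4 * r),
      g y - g x ≤ ℓ (y - x) + K * ‖y - x‖ ^ 2) :
    ∃ K' : ℝ, 0 ≤ K' ∧ ∀ K'' ≥ K', ConcaveOn ℝ univ fun x => φ x * g x - K'' * ‖x‖ ^ 2 := by
  have hcs : HasCompactSupport φ := by
    refine HasCompactSupport.intro (isCompact_closedBall x₀ r) fun x hx => hφs x fun hx' => hx ?_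
    exact Metric.ball_subset_closedBall hx'
  obtain ⟨A, hA0, hA1, hA2, hA3⟩ := hφ.exists_taylor_bound_of_hasCompactSupport hcs
  have hM0 : 0 ≤ M := (abs_nonneg _).trans (hM x₀ (Metric.mem_ball_self (by positivity)))
  have hφg : ∀ x, |φ x * g x| ≤ M := fun x => by
    by_cases hx : x ∈ Metric.ball x₀ r
    · rw [abs_mul, abs_of_nonneg (hφ01 x).1]
      have h1 := hM x (Metric.ball_subset_ball (by linarith) hx)
      nlinarith [hφ01 x, abs_nonneg (g x)]
    · simp [hφs x hx, hM0]
  set L : ℝ := (2 * M + K * r ^ 2) / r with hLdef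
  have hL0 : 0 ≤ L := by positivity
  have hfar : ∀ d : ℝ, r ≤ d → 2 * M + (L + M * A) * d ≤ (2 * M / r ^ 2 + (L + M * A) / r) * d ^ 2 :=
      fun d hd => by
    have h1 : 1 ≤ d / r := (one_le_div hr).2 hd
    have e : (2 * M / r ^ 2 + (L + M * A) / r) * d ^ 2
        = 2 * M * (d / r) ^ 2 + (L + M * A) * d * (d / r) := by field_simp
    rw [e]
    have h2 : 0 ≤ (L + M * A) * d := by have := hr.le.trans hd; positivity
    nlinarith [mul_le_mul_of_nonneg_left h1 h2, mul_nonneg hM0 (by nlinarith : 0 ≤ (d / r) ^ 2 - 1)]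
  set K₁ : ℝ := A * L + K + M * A
  set K₂ : ℝ := 2 * M / r ^ 2 + (L + M * A) / r
  have hK₁ : 0 ≤ K₁ := by positivity
  have hK₂ : 0 ≤ K₂ := by positivity
  refine ⟨K₁ + K₂, by positivity, fun K'' hK'' => concaveOn_sub_of_supergradient fun x => ?_⟩
  have hnear : ∀ d : ℝ, K₁ * d ^ 2 ≤ K'' * d ^ 2 := fun d => by gcongr; linarith
  have hfar' : ∀ d : ℝ, K₂ * d ^ 2 ≤ K'' * d ^ 2 := fun d => by gcongr; linarith
  by_cases hx : x ∈ Metric.ball x₀ (2 * r)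
  · obtain ⟨ℓ, hℓ⟩ := hg x (Metric.ball_subset_ball (by linarith) hx)
    have hℓnorm : ∀ w, ℓ w ≤ L * ‖w‖ := fun w => by
      rcases eq_or_ne w 0 with rfl | hw
      · simp
      have hw' : 0 < ‖w‖ := norm_pos_iff.2 hw
      -- testing at the point at distance `r` from `x` in the direction `-w`
      have hn : ‖(r / ‖w‖) • w‖ = r := by
        rw [norm_smul, Real.norm_eq_abs, abs_of_nonneg (by positivity), div_mul_cancel₀ _ hw'.ne']
      have hy : x - (r / ‖w‖) • w ∈ Metric.ball x₀ (4 * r) := by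
        rw [Metric.mem_ball] at hx ⊢
        have h1 : dist (x - (r / ‖w‖) • w) x = r := by
          rw [dist_eq_norm, sub_sub_cancel_left, norm_neg, hn]
        linarith [dist_triangle (x - (r / ‖w‖) • w) x x₀]
      have h := hℓ _ hy
      rw [sub_sub_cancel_left, norm_neg, hn, map_neg, map_smul, smul_eq_mul] at h
      have h1 := abs_le.1 (hM _ hy)
      have h2 := abs_le.1 (hM x (Metric.ball_subset_ball (by linarith) hx))
      have h3 : r / ‖w‖ * ℓ w ≤ 2 * M + K * r ^ 2 := by linarith
      rw [div_mul_eq_mul_div, div_le_iff₀ hw'] at h3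
      rw [hLdef, div_mul_eq_mul_div, le_div_iff₀ hr]
      linarith
    have hgx := hM x (Metric.ball_subset_ball (by linarith) hx)
    refine ⟨φ x • ℓ + g x • (fderiv ℝ φ x : E →ₗ[ℝ] ℝ), fun y => ?_⟩
    simp only [LinearMap.add_apply, LinearMap.smul_apply, smul_eq_mul,
      ContinuousLinearMap.coe_coe]
    have hℓabs : |ℓ (y - x)| ≤ L * ‖y - x‖ := by
      have h := hℓnorm (-(y - x))
      rw [map_neg, norm_neg] at h
      exact abs_le.2 ⟨by linarith, hℓnorm _⟩
    by_cases hy : ‖y - x‖ < r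
    · have hyb : y ∈ Metric.ball x₀ (4 * r) := by
        rw [Metric.mem_ball] at hx ⊢
        rw [← dist_eq_norm] at hy
        linarith [dist_triangle y x x₀]
      have h1 := mul_le_mul_of_nonneg_left (hℓ y hyb) (hφ01 y).1
      have h2 : φ y * (K * ‖y - x‖ ^ 2) ≤ 1 * (K * ‖y - x‖ ^ 2) := by
        gcongr; exact (hφ01 y).2
      have h3 : (φ y - φ x) * ℓ (y - x) ≤ A * ‖y - x‖ * (L * ‖y - x‖) := by
        refine (le_abs_self _).trans ?_
        rw [abs_mul]
        gcongr
        exact hA1 x y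
      have h4 : g x * (φ y - φ x - fderiv ℝ φ x (y - x)) ≤ M * (A * ‖y - x‖ ^ 2) := by
        refine (le_abs_self _).trans ?_
        rw [abs_mul]
        gcongr
        exact hA3 x y
      refine le_trans ?_ (add_le_add_right (hnear ‖y - x‖) _)
      simp only [K₁]
      linarith
    · have h1 := abs_le.1 (hφg y)
      have h2 := abs_le.1 (hφg x)
      have h3 : |φ x * ℓ (y - x)| ≤ 1 * (L * ‖y - x‖) := by
        rw [abs_mul, abs_of_nonneg (hφ01 x).1]
        gcongr
        exact (hφ01 x).2
      have h4 : |g x * fderiv ℝ φ x (y - x)| ≤ M * (A * ‖y - x‖) := by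
        rw [abs_mul, ← Real.norm_eq_abs (fderiv ℝ φ x (y - x))]
        gcongr
        exact (fderiv ℝ φ x).le_of_opNorm_le (hA2 x) _
      have h5 := abs_le.1 h3
      have h6 := abs_le.1 h4
      have h7 := (hfar _ (not_lt.1 hy)).trans (hfar' ‖y - x‖)
      linarith
  · refine ⟨0, fun y => ?_⟩
    have hx0 : φ x = 0 := hφs x fun h => hx (Metric.ball_subset_ball (by linarith) h)
    rw [hx0, zero_mul, sub_zero, LinearMap.zero_apply, zero_add]
    by_cases hy : ‖y - x‖ < r
    · have hy0 : φ y = 0 := hφs y fun h => hx <| by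
        rw [Metric.mem_ball] at h ⊢
        rw [← dist_eq_norm, dist_comm] at hy
        linarith [dist_triangle x y x₀]
      rw [hy0, zero_mul]
      have := hK₁.trans (by linarith : K₁ ≤ K'')
      positivity
    · have h1 := abs_le.1 (hφg y)
      have h7 := (hfar _ (not_lt.1 hy)).trans (hfar' ‖y - x‖)
      have : 0 ≤ (L + M * A) * ‖y - x‖ := by positivity
      linarith

theorem exists_forall_le_of_supergradient {g : E → ℝ} {x₀ : E} {K ρ : ℝ} (hK : 0 ≤ K)
    (h : ∃ ℓ : E →ₗ[ℝ] ℝ, ∀ y ∈ Metric.ball x₀ ρ,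
      g y - g x₀ ≤ ℓ (y - x₀) + K * ‖y - x₀‖ ^ 2) :
    ∃ M : ℝ, ∀ y ∈ Metric.ball x₀ ρ, g y ≤ M := by
  obtain ⟨ℓ, hℓ⟩ := h
  refine ⟨g x₀ + ‖LinearMap.toContinuousLinearMap ℓ‖ * ρ + K * ρ ^ 2, fun y hy => ?_⟩
  have h1 := hℓ y hy
  rw [Metric.mem_ball, dist_eq_norm] at hy
  have h2 : ℓ (y - x₀) ≤ ‖LinearMap.toContinuousLinearMap ℓ‖ * ‖y - x₀‖ :=
    (le_abs_self _).trans ((LinearMap.toContinuousLinearMap ℓ).le_opNorm (y - x₀))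
  have h3 : ‖LinearMap.toContinuousLinearMap ℓ‖ * ‖y - x₀‖
    ≤ ‖LinearMap.toContinuousLinearMap ℓ‖ * ρ := by gcongr
  have h4 : K * ‖y - x₀‖ ^ 2 ≤ K * ρ ^ 2 := by gcongr
  linarith

/-- Near each point the problem has a solution: on a ball where the cutoff is `1`, the insertion
between `φ f` and `φ g` lies between `f` and `g`. -/
theorem exists_c11_between_near {f g : E → ℝ} {ω ω' : ℝ → ℝ} {O : Set E}
    (hω : IsLinearModulus ω) (hf : LocallySemiconcaveOn ω O fun x => -f x)
    (hω' : IsLinearModulus ω') (hg : LocallySemiconcaveOn ω' O g)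
    (hfg : ∀ x ∈ O, f x ≤ g x) {x₀ : E} (hx₀ : x₀ ∈ O) :
    ∃ r > 0, Metric.closedBall x₀ r ⊆ O ∧ ∃ h : E → ℝ, (∀ x, C11At h x) ∧
      ∀ x ∈ Metric.ball x₀ r, (f x ≤ h x ∧ h x ≤ g x) ∧ (f x < g x → f x < h x ∧ h x < g x) := by
  obtain ⟨K₁, hK₁, ρ₁, hρ₁, hO₁, h₁⟩ := hf.exists_ball hω hx₀
  obtain ⟨K₂, hK₂, ρ₂, hρ₂, hO₂, h₂⟩ := hg.exists_ball hω' hx₀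
  obtain ⟨M₁, hM₁⟩ := exists_forall_le_of_supergradient hK₁
    (h₁ x₀ (Metric.mem_ball_self hρ₁))
  obtain ⟨M₂, hM₂⟩ := exists_forall_le_of_supergradient hK₂
    (h₂ x₀ (Metric.mem_ball_self hρ₂))
  obtain ⟨r, hr, hr₁, hr₂⟩ : ∃ r : ℝ, 0 < r ∧ 4 * r ≤ ρ₁ ∧ 4 * r ≤ ρ₂ :=
    ⟨min ρ₁ ρ₂ / 4, by positivity, by linarith [min_le_left ρ₁ ρ₂],
      by linarith [min_le_right ρ₁ ρ₂]⟩
  have hs₁ := Metric.ball_subset_ball (x := x₀) hr₁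
  have hs₂ := Metric.ball_subset_ball (x := x₀) hr₂
  set M := max M₁ M₂
  -- `f ≤ g` turns the one-sided bounds `-f ≤ M₁` and `g ≤ M₂` into two-sided ones
  have hbf : ∀ x ∈ Metric.ball x₀ (4 * r), |-f x| ≤ M := fun x hx => by
    have := hM₁ x (hs₁ hx); have := hM₂ x (hs₂ hx); have := hfg x (hO₁ (hs₁ hx))
    have := le_max_left M₁ M₂; have := le_max_right M₁ M₂
    exact abs_le.2 ⟨by linarith, by linarith⟩
  have hbg : ∀ x ∈ Metric.ball x₀ (4 * r), |g x| ≤ M := fun x hx => by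
    have := hM₁ x (hs₁ hx); have := hM₂ x (hs₂ hx); have := hfg x (hO₁ (hs₁ hx))
    have := le_max_left M₁ M₂; have := le_max_right M₁ M₂
    exact abs_le.2 ⟨by linarith, by linarith⟩
  let φ : ContDiffBump x₀ := ⟨r / 2, r, by positivity, by linarith⟩
  have hφs : ∀ x ∉ Metric.ball x₀ r, φ x = 0 := fun x hx =>
    φ.zero_of_le_dist (by simpa using hx)
  have hφ01 : ∀ x, 0 ≤ φ x ∧ φ x ≤ 1 := fun x => ⟨φ.nonneg, φ.le_one⟩
  obtain ⟨A₁, hA₁, hc₁⟩ := exists_concaveOn_cutoff hr hK₁ φ.contDiff hφ01 hφs hbf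
    fun x hx => (h₁ x (hs₁ hx)).imp fun ℓ h y hy => h y (hs₁ hy)
  obtain ⟨A₂, hA₂, hc₂⟩ := exists_concaveOn_cutoff hr hK₂ φ.contDiff hφ01 hφs hbg
    fun x hx => (h₂ x (hs₂ hx)).imp fun ℓ h y hy => h y (hs₂ hy)
  obtain ⟨h, hd, hb, hs⟩ := exists_c11_between_strict (f := fun x => φ x * f x)
    (g := fun x => φ x * g x) (K := max A₁ A₂) (hA₁.trans (le_max_left _ _))
    ((hc₁ _ (le_max_left A₁ A₂)).neg.congr fun x _ => by simp only [Pi.neg_apply]; ring)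
    (hc₂ _ (le_max_right A₁ A₂)) (fun x => by
      by_cases hx : x ∈ Metric.ball x₀ r
      · exact mul_le_mul_of_nonneg_left
          (hfg x (hO₁ (hs₁ (Metric.ball_subset_ball (by linarith) hx)))) φ.nonneg
      · simp [hφs x hx])
  refine ⟨r / 2, by positivity, ?_, h, hd, fun x hx => ?_⟩
  · exact (Metric.closedBall_subset_ball (by linarith)).trans (hs₁.trans hO₁)
  · have hx1 : φ x = 1 := φ.one_of_mem_closedBall (Metric.ball_subset_closedBall hx)
    have h3 := hb x
    have h4 := hs x
    simp only [hx1, one_mul] at h3 h4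
    exact ⟨h3, h4⟩

end Cutoff

/-! ### Patching on the manifold -/

section Patching

variable {n : ℕ} {M : Type*} [TopologicalSpace M]

theorem c11At_finsum_comp_symm {ι : Type*} {V : ι → Set M} (hV : LocallyFinite V)
    {e' : OpenPartialHomeomorph M (EuclideanSpace ℝ (Fin n))} {u : ι → M → ℝ}
    (hu : ∀ i, ∀ y ∉ V i, u i y = 0) {z : EuclideanSpace ℝ (Fin n)} (hz : z ∈ e'.target)
    (hc : ∀ i, C11At (u i ∘ e'.symm) z) : C11At ((fun y => ∑ᶠ i, u i y) ∘ e'.symm) z := by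
  obtain ⟨t, ht, hfin⟩ := hV (e'.symm z)
  refine (C11At.sum hfin.toFinset fun i _ => hc i).congr_of_eventuallyEq ?_
  filter_upwards [(e'.continuousAt_symm hz).eventually ht] with z' hz'
  refine finsum_eq_sum_of_support_subset _ fun i hi => ?_
  have : e'.symm z' ∈ V i := by
    by_contra h
    exact hi (hu i _ h)
  simpa using ⟨_, this, hz'⟩

variable [ChartedSpace (EuclideanSpace ℝ (Fin n)) M]

theorem contDiffAt_transition [IsManifold (𝓡 n) 2 M]
    {e e' : OpenPartialHomeomorph M (EuclideanSpace ℝ (Fin n))}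
    (he : e ∈ IsManifold.maximalAtlas (𝓡 n) 2 M) (he' : e' ∈ IsManifold.maximalAtlas (𝓡 n) 2 M)
    {z : EuclideanSpace ℝ (Fin n)} (hz : z ∈ e'.target) (hz' : e'.symm z ∈ e.source) :
    ContDiffAt ℝ 2 (e ∘ e'.symm) z := by
  have h1 : ContMDiffAt (𝓡 n) (𝓡 n) 2 e (e'.symm z) :=
    (contMDiffOn_of_mem_maximalAtlas he).contMDiffAt (e.open_source.mem_nhds hz')
  have h2 : ContMDiffAt (𝓡 n) (𝓡 n) 2 e'.symm z :=
    (contMDiffOn_symm_of_mem_maximalAtlas he').contMDiffAt (e'.open_target.mem_nhds hz)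
  exact contMDiffAt_iff_contDiffAt.1 (h1.comp z h2)

/-- A `C^{1,1}` function read in a chart and supported in a compact part of it extends by zero to a
function that is `C^{1,1}` in every chart. -/
theorem c11At_comp_symm_of_compact_support [IsManifold (𝓡 n) 2 M] [T2Space M]
    {e e' : OpenPartialHomeomorph M (EuclideanSpace ℝ (Fin n))}
    (he : e ∈ IsManifold.maximalAtlas (𝓡 n) 2 M) (he' : e' ∈ IsManifold.maximalAtlas (𝓡 n) 2 M)
    {u : M → ℝ} {w : EuclideanSpace ℝ (Fin n) → ℝ} {K : Set (EuclideanSpace ℝ (Fin n))}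
    (hK : IsCompact K) (hKe : K ⊆ e.target) (hw : ∀ z, C11At w z)
    (huw : ∀ y ∈ e.source, u y = w (e y)) (hu : ∀ y ∉ e.symm '' K, u y = 0)
    {z : EuclideanSpace ℝ (Fin n)} (hz : z ∈ e'.target) : C11At (u ∘ e'.symm) z := by
  have hcont : ContinuousAt e'.symm z := e'.continuousAt_symm hz
  by_cases hy : e'.symm z ∈ e.source
  · refine ((hw _).comp (contDiffAt_transition he he' hz hy).c11At).congr_of_eventuallyEq ?_
    filter_upwards [hcont.eventually (e.open_source.mem_nhds hy)] with z' hz'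
    exact huw _ hz'
  · have hclosed : IsClosed (e.symm '' K) :=
      (hK.image_of_continuousOn (e.continuousOn_symm.mono hKe)).isClosed
    have hmem : e'.symm z ∈ (e.symm '' K)ᶜ := by
      rintro ⟨k, hk, hk'⟩
      exact hy (hk' ▸ e.map_target (hKe hk))
    refine (contDiffAt_const (c := (0 : ℝ))).c11At.congr_of_eventuallyEq ?_
    filter_upwards [hcont.eventually (hclosed.isOpen_compl.mem_nhds hmem)] with z' hz'
    exact hu _ hz'

end Patching

theorem corollary3p3 (n : ℕ) (M : Type*) [TopologicalSpace M]
    [ChartedSpace (EuclideanSpace ℝ (Fin n)) M] [IsManifold (𝓡 n) 2 M]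
    [T2Space M] [ParacompactSpace M] (f g : M → ℝ)
    (hf : MLocallySemiconvex n f) (hg : MLocallySemiconcave n g) (hfg : ∀ x, f x ≤ g x) :
    ∃ h : M → ℝ, MIsC11 n h ∧ (∀ x, f x ≤ h x ∧ h x ≤ g x) ∧
      ∀ x ∉ {y : M | f y = g y}, f x < h x ∧ h x < g x := by
  let e (x : M) := chartAt (EuclideanSpace ℝ (Fin n)) x
  have he (x : M) : e x ∈ IsManifold.maximalAtlas (𝓡 n) 2 M :=
    IsManifold.chart_mem_maximalAtlas x
  have hloc (x : M) : ∃ r > 0, Metric.closedBall (e x x) r ⊆ (e x).target ∧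
      ∃ h : EuclideanSpace ℝ (Fin n) → ℝ, (∀ z, C11At h z) ∧
        ∀ y ∈ (e x).source ∩ e x ⁻¹' Metric.ball (e x x) r,
          (f y ≤ h (e x y) ∧ h (e x y) ≤ g y) ∧
            (f y < g y → f y < h (e x y) ∧ h (e x y) < g y) := by
    obtain ⟨ω, hω, hfω⟩ := hf _ (he x)
    obtain ⟨ω', hω', hgω⟩ := hg _ (he x)
    obtain ⟨r, hr, hball, h, hd, hb⟩ := exists_c11_between_near (f := f ∘ (e x).symm) hω hfω hω' hgω
      (fun z _ => hfg _) ((e x).map_source (mem_chart_source _ x))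
    refine ⟨r, hr, hball, h, hd, fun y hy => ?_⟩
    simpa [(e x).left_inv hy.1] using hb _ hy.2
  choose r hr hball h hd hb using hloc
  let U (x : M) : Set M := (e x).source ∩ e x ⁻¹' Metric.ball (e x x) (r x)
  obtain ⟨V, hVo, hVcover, hVfin, hVU⟩ := precise_refinement U
    (fun x => (e x).isOpen_inter_preimage Metric.isOpen_ball)
    (iUnion_eq_univ_iff.2 fun x => ⟨x, mem_chart_source _ x, Metric.mem_ball_self (hr x)⟩)
  have hVs (x : M) : V x ⊆ (e x).source := fun y hy => (hVU x hy).1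
  have hφ (x : M) := ((e x).isOpen_image_of_subset_source (hVo x)
    (hVs x)).exists_contDiff_support_eq (n := 2)
  choose φ hφs hφd hφr using hφ
  have hφ0 (x : M) (z) : 0 ≤ φ x z := (hφr x (mem_range_self z)).1
  -- bump functions, positive exactly on the members of the locally finite cover
  let b (x : M) : M → ℝ := (e x).source.indicator (φ x ∘ e x)
  have hb0 (x y : M) (hy : y ∉ V x) : b x y = 0 := by
    by_cases hys : y ∈ (e x).source
    · simp only [b]
      rw [indicator_of_mem hys]
      by_contra hne
      have : e x y ∈ e x '' V x := hφs x ▸ hne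
      obtain ⟨y', hy', heq⟩ := this
      exact hy ((e x).injOn (hVs x hy') hys heq ▸ hy')
    · exact indicator_of_notMem hys _
  have hbpos (x y : M) (hy : y ∈ V x) : 0 < b x y := by
    simp only [b, indicator_of_mem (hVs x hy)]
    refine lt_of_le_of_ne (hφ0 x _) (Ne.symm ?_)
    have : e x y ∈ Function.support (φ x) := hφs x ▸ mem_image_of_mem _ hy
    exact this
  have hVK (x y : M) (hy : y ∉ (e x).symm '' Metric.closedBall (e x x) (r x)) : y ∉ V x :=
    fun hyV => hy ⟨e x y, Metric.ball_subset_closedBall (hVU x hyV).2, (e x).left_inv (hVs x hyV)⟩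
  have hφc (x : M) (z) : C11At (φ x) z := (hφd x).contDiffAt.c11At
  let N (y : M) : ℝ := ∑ᶠ x, b x y * h x (e x y)
  let D (y : M) : ℝ := ∑ᶠ x, b x y
  have hsum (c : M → M → ℝ) (y : M) :
      ∑ᶠ x, b x y * c x y = ∑ x ∈ (hVfin.point_finite y).toFinset, b x y * c x y := by
    refine finsum_eq_sum_of_support_subset _ fun x hx => ?_
    have : y ∈ V x := by
      by_contra hy
      exact hx (by simp [hb0 x y hy])
    simpa using this
  have hD (y : M) : D y = ∑ x ∈ (hVfin.point_finite y).toFinset, b x y := by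
    simpa using hsum (fun _ _ => 1) y
  have hne (y : M) : (hVfin.point_finite y).toFinset.Nonempty := by
    obtain ⟨x, hx⟩ := iUnion_eq_univ_iff.1 hVcover y
    exact ⟨x, by simpa using hx⟩
  have hDpos (y : M) : 0 < D y := by
    rw [hD]
    exact Finset.sum_pos (fun x hx => hbpos x y (by simpa using hx)) (hne y)
  have hN (y : M) : N y = ∑ x ∈ (hVfin.point_finite y).toFinset, b x y * h x (e x y) :=
    hsum (fun x y => h x (e x y)) y
  refine ⟨fun y => N y / D y, fun e' he' => isC11On_of_forall_c11At fun z hz => ?_,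
    fun y => ⟨?_, ?_⟩, fun y hy => ?_⟩
  · refine C11At.div (f := N ∘ e'.symm) (g := D ∘ e'.symm) ?_ ?_ (hDpos _).ne'
    · refine c11At_finsum_comp_symm hVfin (fun x y hy => by simp [hb0 x y hy]) hz fun x => ?_
      refine c11At_comp_symm_of_compact_support (he x) he' (isCompact_closedBall _ _) (hball x)
        (fun z => (hφc x z).mul (hd x z)) (fun y hy => ?_)
        (fun y hy => by simp [hb0 x y (hVK x y hy)]) hz
      simp [b, indicator_of_mem hy]
    · refine c11At_finsum_comp_symm hVfin hb0 hz fun x => ?_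
      exact c11At_comp_symm_of_compact_support (he x) he' (isCompact_closedBall _ _) (hball x)
        (hφc x) (fun y hy => indicator_of_mem hy _) (fun y hy => hb0 x y (hVK x y hy)) hz
  · rw [le_div_iff₀ (hDpos y), hN, hD, Finset.mul_sum]
    refine Finset.sum_le_sum fun x hx => ?_
    have hx' : y ∈ V x := by simpa using hx
    rw [mul_comm]
    exact mul_le_mul_of_nonneg_left (hb x y (hVU x hx')).1.1 (hbpos x y hx').le
  · rw [div_le_iff₀ (hDpos y), hN, hD, Finset.mul_sum]
    refine Finset.sum_le_sum fun x hx => ?_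
    have hx' : y ∈ V x := by simpa using hx
    rw [mul_comm (g y)]
    exact mul_le_mul_of_nonneg_left (hb x y (hVU x hx')).1.2 (hbpos x y hx').le
  · have hlt : f y < g y := lt_of_le_of_ne (hfg y) hy
    constructor
    · rw [lt_div_iff₀ (hDpos y), hN, hD, Finset.mul_sum]
      refine Finset.sum_lt_sum_of_nonempty (hne y) fun x hx => ?_
      have hx' : y ∈ V x := by simpa using hx
      rw [mul_comm]
      exact mul_lt_mul_of_pos_left ((hb x y (hVU x hx')).2 hlt).1 (hbpos x y hx')
    · rw [div_lt_iff₀ (hDpos y), hN, hD, Finset.mul_sum]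
      refine Finset.sum_lt_sum_of_nonempty (hne y) fun x hx => ?_
      have hx' : y ∈ V x := by simpa using hx
      rw [mul_comm (g y)]
      exact mul_lt_mul_of_pos_left ((hb x y (hVU x hx')).2 hlt).2 (hbpos x y hx')
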